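/- For $n\ge 1$ let $S_n$ be the symmetric group on $[n]=\{1,\dots,n\}$, let $D(\pi)=\{i\in[n-1] : \pi(i)>\pi(i+1)\}$ be the descent set of $\pi\in S_n$, and let $C_n\subseteq S_n$ be the set of $n$-cycles, that is, of permutations of cycle type $(n)$. For $J\subseteq[n-1]$ put $\beta_n(J)=\#\{\pi\in S_n : D(\pi)=J\}$ and $\beta^{\mathrm{cyc}}_n(J)=\#\{\pi\in C_n : D(\pi)=J\}$. Let $\mathbb{P}$ be the set of positive integers; for $\ell\ge 1$, a set $I\subseteq\mathbb{P}$ is called $\ell$-periodic if, for each $i\in\mathbb{P}$, $i\in I$ if and only if $i+\ell\in I$. Fix $k\ge 2$, and define $$\mathcal{I}_n=\{\,I\cap[n-1] : \varnothing\subsetneq I\subsetneq\mathbb{P}\text{ and } I \text{ is } \ell\text{-periodic for some } \ell \text{ with } 1\le\ell\le k\,\}.$$ Then $$\lim_{n\to\infty}\ \max_{J\in\mathcal{I}_n}\left|\frac{n\,\beta^{\mathrm{cyc}}_n(J)}{\beta_n(J)}-1\right|=0.$$ -/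

import Mathlib

open Filter Topology

namespace CyclicDescents

/-- The descent set `D(π) = {i ∈ [n-1] : π(i) > π(i+1)}` of a permutation of `[n] = {1, …, n}`.
The element `a : Fin n` stands for the position (and the value) `a + 1` of `[n]`. -/
def descentSet {n : ℕ} (π : Equiv.Perm (Fin n)) : Finset ℕ :=
  {i ∈ Finset.Icc 1 (n - 1) |
    ∃ a b : Fin n, (a : ℕ) + 1 = i ∧ (b : ℕ) + 1 = i + 1 ∧ π a > π b}

/-- `π` is an `n`-cycle: its cycle type, as a partition of `n` in which fixed points are recorded
as parts equal to `1`, is `(n)`. (So the identity of `S_1` is a `1`-cycle.) -/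
def IsFullCycle {n : ℕ} (π : Equiv.Perm (Fin n)) : Prop :=
  π.partition.parts = {n}

/-- `β_n(J)`: the number of permutations of `[n]` with descent set `J`. -/
noncomputable def beta (n : ℕ) (J : Finset ℕ) : ℕ :=
  Nat.card {π : Equiv.Perm (Fin n) // descentSet π = J}

/-- `β^cyc_n(J)`: the number of `n`-cycles with descent set `J`. -/
noncomputable def betaCyc (n : ℕ) (J : Finset ℕ) : ℕ :=
  Nat.card {π : Equiv.Perm (Fin n) // IsFullCycle π ∧ descentSet π = J}

/-- The set `ℙ` of positive integers. -/
def posInts : Set ℕ := {i | 1 ≤ i}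

/-- `I ⊆ ℙ` is `ℓ`-periodic: for each `i ∈ ℙ`, `i ∈ I` if and only if `i + ℓ ∈ I`. -/
def IsPeriodic (ℓ : ℕ) (I : Set ℕ) : Prop :=
  ∀ i ∈ posInts, (i ∈ I ↔ i + ℓ ∈ I)

open Classical in
/-- The finite family of the sets `I ∩ [n-1]`, where `I` runs over the nonempty proper subsets of
`ℙ` that are `ℓ`-periodic for some `1 ≤ ℓ ≤ k`. -/
noncomputable def periodicFamily (k n : ℕ) : Finset (Finset ℕ) :=
  {J ∈ (Finset.Icc 1 (n - 1)).powerset |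
    ∃ I : Set ℕ, ∅ ⊂ I ∧ I ⊂ posInts ∧ (∃ ℓ, 1 ≤ ℓ ∧ ℓ ≤ k ∧ IsPeriodic ℓ I) ∧
      (J : Set ℕ) = I ∩ Set.Icc 1 (n - 1)}

/-- The family is nonempty when `k ≥ 2`, so that a maximum over it makes sense. -/
theorem periodicFamily_nonempty {k : ℕ} (hk : 2 ≤ k) (n : ℕ) : (periodicFamily k n).Nonempty := by
  classical
  refine ⟨(Finset.Icc 1 (n - 1)).filter (fun i => i % 2 = 0), ?_⟩
  simp only [periodicFamily, Finset.mem_filter, Finset.mem_powerset]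
  refine ⟨Finset.filter_subset _ _, {i | 1 ≤ i ∧ i % 2 = 0}, ?_, ?_, ⟨2, by omega, hk, ?_⟩, ?_⟩
  · rw [Set.empty_ssubset]
    exact ⟨2, by simp⟩
  · refine ⟨fun i hi => hi.1, fun h => ?_⟩
    have h1 := h (show (1 : ℕ) ∈ posInts from le_refl 1)
    simp at h1
  · intro i hi
    have hi' : 1 ≤ i := hi
    simp only [Set.mem_ofPred_eq]
    omega
  · ext i
    simp only [Finset.coe_filter, Finset.mem_Icc, Set.mem_ofPred_eq, Set.mem_inter_iff, Set.mem_Icc]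
    omega

end CyclicDescents

/-! Permutations with descent set inside `K` correspond to the rearrangements of a word whose
letters label the blocks cut out by `K`. In the spirit of Gessel and Reutenauer, `n` times the
number of such `n`-cycles is the number of primitive rearrangements (`card_fullCycles_mul`,
`card_conj_increasingOnLevels`). The two counts differ by the non-primitive words, which have a
period at most `n / 2` and so number at most `n * n ^ (n / 2)`. Inclusion–exclusion over subsets
costs a factor `2 ^ J.card` (`abs_mul_betaCyc_sub_beta_le`).

Periodicity bounds the runs of ascents and descents, so the zigzag poset of `J` has a level function
with `2 * k` levels, whence `β_n(J) ≥ n! / (2k)^n`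
(`factorial_le_beta_mul_pow_of_mem_periodicFamily`). The relative error is at most an exponential
times `n ^ (n / 2) / n!`, uniformly in `J`, and tends to `0`. -/

namespace CyclicDescents

/-! ### Words and permutations increasing on blocks -/

/-- `π` is increasing on each level set of `c`. -/
def IncreasingOnLevels {n : ℕ} (c : Fin n → ℕ) (π : Equiv.Perm (Fin n)) : Prop :=
  ∀ x y, x < y → c x = c y → π x < π y

/-- Distinct positions of the word `w` have distinct forward itineraries under `ρ`. -/
def IsPrimitiveWord {n : ℕ} (ρ : Equiv.Perm (Fin n)) (w : Fin n → ℕ) : Prop :=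
  ∀ x y, (∀ t : ℕ, w ((ρ ^ t) x) = w ((ρ ^ t) y)) → x = y

open Classical in
/-- The rearrangements of the word `c`. -/
noncomputable def rearrangements {n : ℕ} (c : Fin n → ℕ) : Finset (Fin n → ℕ) :=
  Finset.univ.image fun σ : Equiv.Perm (Fin n) => c ∘ σ

theorem mem_rearrangements {n : ℕ} {c w : Fin n → ℕ} :
    w ∈ rearrangements c ↔ ∃ σ : Equiv.Perm (Fin n), c ∘ σ = w := by
  simp [rearrangements]

theorem comp_sort_of_mem_rearrangements {n : ℕ} {c w : Fin n → ℕ} (hc : Monotone c)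
    (hw : w ∈ rearrangements c) (τ : Equiv.Perm (Fin n)) (hτ : Monotone (w ∘ τ)) :
    w ∘ τ = c := by
  obtain ⟨σ, rfl⟩ := mem_rearrangements.1 hw
  rw [Tuple.comp_sort_eq_comp_iff_monotone.2 hτ, Tuple.comp_perm_comp_sort_eq_comp_sort]
  exact (Tuple.comp_sort_eq_comp_iff_monotone (σ := 1).2 hc).symm

-- `Tuple.sort` is stable: it breaks ties by position, so the sorting permutation of a rearrangement
-- is increasing on each level. The inverse map is `π ↦ c ∘ π⁻¹`.
open Classical in
theorem card_increasingOnLevels {n : ℕ} {c : Fin n → ℕ} (hc : Monotone c) :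
    (Finset.univ.filter (IncreasingOnLevels c)).card = (rearrangements c).card := by
  symm
  refine Finset.card_bij' (fun w _ => Tuple.sort w) (fun π _ => c ∘ (π⁻¹ : Equiv.Perm (Fin n)))
    ?_ ?_ ?_ ?_
  · intro w hw
    simp only [Finset.mem_filter, Finset.mem_univ, true_and]
    intro x y hxy h
    have h1 := comp_sort_of_mem_rearrangements hc hw _ (Tuple.monotone_sort w)
    refine (Tuple.eq_sort_iff.1 (rfl : Tuple.sort w = Tuple.sort w)).2 x y hxy ?_
    have h2 := congrFun h1 x
    have h3 := congrFun h1 y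
    simp only [Function.comp_apply] at h2 h3
    rw [h2, h3, h]
  · intro π _
    exact mem_rearrangements.2 ⟨_, rfl⟩
  · intro w hw
    have h1 := comp_sort_of_mem_rearrangements hc hw _ (Tuple.monotone_sort w)
    funext x
    simp [← h1]
  · intro π hπ
    simp only [Finset.mem_filter, Finset.mem_univ, true_and] at hπ
    symm
    rw [Tuple.eq_sort_iff]
    refine ⟨?_, ?_⟩
    · intro x y hxy
      simpa using hc hxy
    · intro x y hxy h
      exact hπ x y hxy (by simpa using h)

/-! ### Conjugates of a transitive cycle and primitive words -/

section Primitive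

variable {n : ℕ} {c : Fin n → ℕ} {ρ : Equiv.Perm (Fin n)}

theorem conj_apply_apply (r ρ : Equiv.Perm (Fin n)) (x : Fin n) :
    (r * ρ * r⁻¹) (r x) = r (ρ x) := by simp

theorem lt_pow_of_lt {r : Equiv.Perm (Fin n)} (hr : IncreasingOnLevels c (r * ρ * r⁻¹))
    {x y : Fin n} (hxy : r x < r y)
    (hw : ∀ t : ℕ, c (r ((ρ ^ t) x)) = c (r ((ρ ^ t) y))) (t : ℕ) :
    r ((ρ ^ t) x) < r ((ρ ^ t) y) := by
  induction t with
  | zero => simpa using hxy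
  | succ t ih =>
    have := hr _ _ ih (hw t)
    rw [conj_apply_apply, conj_apply_apply] at this
    simpa [pow_succ'] using this

/-- If `x` and `ρ ^ s x` had equal itineraries, `r` would order them the same way along the whole
orbit; this fails where `r` attains its maximum. -/
theorem isPrimitiveWord_comp (hρ : ∀ x y, ∃ t : ℕ, (ρ ^ t) x = y) {r : Equiv.Perm (Fin n)}
    (hr : IncreasingOnLevels c (r * ρ * r⁻¹)) : IsPrimitiveWord ρ (c ∘ r) := by
  have key : ∀ x y, r x < r y → ¬ ∀ t : ℕ, c (r ((ρ ^ t) x)) = c (r ((ρ ^ t) y)) := by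
    intro x y hxy hw
    obtain ⟨s, rfl⟩ := hρ x y
    have h1 := lt_pow_of_lt hr hxy hw
    have : Nonempty (Fin n) := ⟨x⟩
    obtain ⟨z, hz⟩ := Finite.exists_max (fun z => r z)
    obtain ⟨t, rfl⟩ := hρ x z
    have h2 := h1 t
    rw [← Equiv.Perm.mul_apply (ρ ^ t), ← pow_add, add_comm, pow_add, Equiv.Perm.mul_apply] at h2
    exact absurd (hz _) (not_le.2 h2)
  intro x y hw
  by_contra hne
  rcases lt_or_gt_of_ne (fun h => hne (r.injective h)) with h | h
  · exact key x y h hw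
  · exact key y x h fun t => (hw t).symm

/-- If `r` and `r'` order two positions oppositely, monotonicity of `c` forces equal letters there,
so the disagreement propagates under `ρ` and the itineraries coincide, against primitivity. -/
theorem comp_injOn (hc : Monotone c) {r r' : Equiv.Perm (Fin n)}
    (hρ : ∀ x y, ∃ t : ℕ, (ρ ^ t) x = y)
    (hr : IncreasingOnLevels c (r * ρ * r⁻¹)) (hr' : IncreasingOnLevels c (r' * ρ * r'⁻¹))
    (h : c ∘ r = c ∘ r') : r = r' := by
  have hc' : ∀ x, c (r x) = c (r' x) := fun x => congrFun h x
  have key : ∀ x y, r x < r y → r' x < r' y := by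
    intro x y hxy
    by_contra hlt
    have hne : x ≠ y := fun h => by simp [h] at hxy
    have hlt' : r' y < r' x := lt_of_le_of_ne (not_lt.1 hlt) fun h => hne (r'.injective h).symm
    have h1 : ∀ t : ℕ, r ((ρ ^ t) x) < r ((ρ ^ t) y) ∧ r' ((ρ ^ t) y) < r' ((ρ ^ t) x) ∧
        c (r ((ρ ^ t) x)) = c (r ((ρ ^ t) y)) := by
      have h3 : ∀ x y, r x < r y → r' y < r' x → c (r x) = c (r y) := fun x y h4 h5 =>
        le_antisymm (hc h4.le) (by rw [hc' x, hc' y]; exact hc h5.le)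
      intro t
      induction t with
      | zero => exact ⟨hxy, hlt', h3 _ _ hxy hlt'⟩
      | succ t ih =>
        obtain ⟨i1, i2, i3⟩ := ih
        have h4 := hr _ _ i1 i3
        have h5 := hr' _ _ i2 (by rw [← hc', ← hc', i3])
        rw [conj_apply_apply, conj_apply_apply] at h4 h5
        rw [pow_succ']
        exact ⟨h4, h5, h3 _ _ h4 h5⟩
    exact hne (isPrimitiveWord_comp hρ hr x y fun t => (h1 t).2.2)
  have hmono : StrictMono (r' ∘ (r⁻¹ : Equiv.Perm (Fin n))) := by
    intro a b hab
    exact key _ _ (by simpa using hab)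
  have hid : r' ∘ (r⁻¹ : Equiv.Perm (Fin n)) = id :=
    hmono.eq_id
  ext x
  have := congrFun hid (r x)
  simp at this
  rw [this]

/-- `r` ranks positions by their itineraries in lexicographic order. Dropping a common first letter
preserves this order, which is the required monotonicity on levels. -/
theorem exists_comp_eq_of_isPrimitiveWord (hc : Monotone c) {w : Fin n → ℕ}
    (hw : w ∈ rearrangements c) (hp : IsPrimitiveWord ρ w) :
    ∃ r : Equiv.Perm (Fin n), IncreasingOnLevels c (r * ρ * r⁻¹) ∧ c ∘ r = w := by
  let f : Fin n → Lex (ℕ → ℕ) := fun x => toLex fun t => w ((ρ ^ t) x)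
  have hf : Function.Injective f := by
    intro x y hxy
    exact hp x y fun t => congrFun (toLex.injective hxy) t
  have hfm : StrictMono (f ∘ Tuple.sort f) :=
    (Tuple.monotone_sort f).strictMono_of_injective (hf.comp (Tuple.sort f).injective)
  have hle : ∀ x y, f x ≤ f y → w x ≤ w y := by
    intro x y h
    rcases h.eq_or_lt with h | h
    · rw [hf h]
    · obtain ⟨i, h1, h2⟩ := h
      rcases Nat.eq_zero_or_pos i with rfl | hi
      · exact h2.le
      · exact (h1 0 hi).le
  have hstep : ∀ x y, f x < f y → w x = w y → f (ρ x) < f (ρ y) := by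
    rintro x y ⟨i, h1, h2⟩ h
    rcases i with _ | i
    · exact absurd h (ne_of_lt h2)
    · refine ⟨i, fun j hj => ?_, ?_⟩
      · have := h1 (j + 1) (Nat.succ_lt_succ hj)
        simpa [f, pow_succ] using this
      · simpa [f, pow_succ] using h2
  have hcw : w ∘ Tuple.sort f = c :=
    comp_sort_of_mem_rearrangements hc hw _ fun x y hxy => hle _ _ (hfm.monotone hxy)
  refine ⟨(Tuple.sort f)⁻¹, ?_, ?_⟩
  · intro x y hxy hcxy
    rw [← hcw] at hcxy
    have h1 := hstep _ _ (hfm hxy) hcxy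
    refine hfm.lt_iff_lt.1 ?_
    change f (Tuple.sort f ((Tuple.sort f).symm _)) < f (Tuple.sort f ((Tuple.sort f).symm _))
    rw [Equiv.apply_symm_apply, Equiv.apply_symm_apply]
    exact h1
  · rw [← hcw]
    funext x
    simp

open Classical in
theorem card_conj_increasingOnLevels (hc : Monotone c) (hρ : ∀ x y, ∃ t : ℕ, (ρ ^ t) x = y) :
    (Finset.univ.filter fun r : Equiv.Perm (Fin n) => IncreasingOnLevels c (r * ρ * r⁻¹)).card =
      ((rearrangements c).filter (IsPrimitiveWord ρ)).card := by
  refine Finset.card_bij (fun r _ => c ∘ r) ?_ ?_ ?_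
  · intro r hr
    simp only [Finset.mem_filter, Finset.mem_univ, true_and] at hr ⊢
    exact ⟨mem_rearrangements.2 ⟨r, rfl⟩, isPrimitiveWord_comp hρ hr⟩
  · intro r hr r' hr' h
    simp only [Finset.mem_filter, Finset.mem_univ, true_and] at hr hr'
    exact comp_injOn hc hρ hr hr' h
  · intro w hw
    simp only [Finset.mem_filter] at hw
    obtain ⟨r, hr, h⟩ := exists_comp_eq_of_isPrimitiveWord hc hw.1 hw.2
    exact ⟨r, by simpa using hr, h⟩

end Primitive

/-! ### Full cycles as conjugates of the rotation -/

theorem isFullCycle_iff_cycleType {N : ℕ} (π : Equiv.Perm (Fin (N + 2))) :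
    IsFullCycle π ↔ π.cycleType = {N + 2} := by
  rw [IsFullCycle, Equiv.Perm.parts_partition]
  constructor
  · intro h
    have h1 : N + 2 ∈ π.cycleType +
        Multiset.replicate (Fintype.card (Fin (N + 2)) - π.support.card) 1 := by
      rw [h]; simp
    rcases Multiset.mem_add.1 h1 with h2 | h2
    · refine (Multiset.eq_of_le_of_card_le (Multiset.singleton_le.2 h2) ?_).symm
      have := congrArg Multiset.card h
      simp only [Multiset.card_add, Multiset.card_singleton] at this ⊢
      omega
    · have := Multiset.eq_of_mem_replicate h2
      omega
  · intro h
    have h1 := Equiv.Perm.sum_cycleType π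
    rw [h] at h1 ⊢
    simp only [Multiset.sum_singleton] at h1
    rw [← h1]
    simp

theorem exists_pow_finRotate (N : ℕ) (x y : Fin (N + 2)) :
    ∃ t : ℕ, (finRotate (N + 2) ^ t) x = y := by
  have h : ∀ z : Fin (N + 2), finRotate (N + 2) z ≠ z := fun z =>
    Equiv.Perm.mem_support.1 (by rw [support_finRotate]; simp)
  exact isCycle_finRotate.exists_pow_eq (h x) (h y)

open Classical in
theorem card_fullCycles_mul {N : ℕ} (p : Equiv.Perm (Fin (N + 2)) → Prop) :
    (N + 2) * (Finset.univ.filter fun π : Equiv.Perm (Fin (N + 2)) =>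
      IsFullCycle π ∧ p π).card =
      (Finset.univ.filter fun r : Equiv.Perm (Fin (N + 2)) =>
        p (r * finRotate (N + 2) * r⁻¹)).card := by
  set ρ := finRotate (N + 2) with hρ
  have hcyc : ∀ π : Equiv.Perm (Fin (N + 2)), IsFullCycle π ↔ ∃ r, r * ρ * r⁻¹ = π := by
    intro π
    rw [isFullCycle_iff_cycleType, ← cycleType_finRotate, eq_comm,
      ← Equiv.Perm.isConj_iff_cycleType_eq, isConj_iff]
  rw [mul_comm]
  have h0 : ((Finset.univ.filter fun π : Equiv.Perm (Fin (N + 2)) => IsFullCycle π ∧ p π) ×ˢ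
      (Finset.univ : Finset (Fin (N + 2)))).card = (Finset.univ.filter
        fun π : Equiv.Perm (Fin (N + 2)) => IsFullCycle π ∧ p π).card * (N + 2) := by
    simp
  rw [← h0]
  symm
  -- A conjugator is determined by the resulting cycle and the image of `0`, since `ρ` is
  -- transitive.
  refine Finset.card_bij (fun r _ => (r * ρ * r⁻¹, r 0)) ?_ ?_ ?_
  · intro r hr
    simp only [Finset.mem_filter, Finset.mem_univ, true_and, Finset.mem_product, and_true] at hr ⊢
    exact ⟨(hcyc _).2 ⟨r, rfl⟩, hr⟩
  · intro r _ r' _ h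
    obtain ⟨h1, h2⟩ := Prod.mk.inj h
    have h3 : ∀ t : ℕ, r ((ρ ^ t) 0) = r' ((ρ ^ t) 0) := by
      intro t
      induction t with
      | zero => simpa using h2
      | succ t ih =>
        rw [pow_succ', Equiv.Perm.mul_apply, ← conj_apply_apply r, ← conj_apply_apply r', h1, ih]
    ext x
    obtain ⟨t, rfl⟩ := exists_pow_finRotate N 0 x
    rw [h3 t]
  · rintro ⟨π, i⟩ h
    simp only [Finset.mem_filter, Finset.mem_univ, true_and, Finset.mem_product, and_true] at h
    obtain ⟨r, rfl⟩ := (hcyc π).1 h.1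
    obtain ⟨t, ht⟩ := exists_pow_finRotate N 0 (r⁻¹ i)
    have h4 : r * ρ ^ t * ρ * (r * ρ ^ t)⁻¹ = r * ρ * r⁻¹ := by
      rw [mul_assoc r, ← pow_succ, pow_succ']
      group
    refine ⟨r * ρ ^ t, ?_, ?_⟩
    · simp only [Finset.mem_filter, Finset.mem_univ, true_and, h4]
      exact h.2
    · rw [h4, Equiv.Perm.mul_apply, ht]
      simp

/-! ### Counting non-primitive words -/

theorem finRotate_pow_apply {N : ℕ} (t : ℕ) (x : Fin (N + 2)) :
    (((finRotate (N + 2) ^ t) x : Fin (N + 2)) : ℕ) = (x + t) % (N + 2) := by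
  induction t with
  | zero => simp [Nat.mod_eq_of_lt x.isLt]
  | succ t ih =>
    rw [pow_succ', Equiv.Perm.mul_apply, finRotate_apply, Fin.val_add, ih]
    simp [← add_assoc]

/-- The values of a word that is not primitive repeat with a period that is a proper divisor of its
length. -/
theorem exists_period_of_not_isPrimitiveWord {N : ℕ} {w : Fin (N + 2) → ℕ}
    (hw : ¬ IsPrimitiveWord (finRotate (N + 2)) w) :
    ∃ g : ℕ, 0 < g ∧ g ≤ (N + 2) / 2 ∧ ∀ x y : Fin (N + 2), (y : ℕ) = x % g → w x = w y := by
  simp only [IsPrimitiveWord, not_forall] at hw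
  obtain ⟨x, y, hxy, hne⟩ := hw
  -- The periodic extension of `w` to `ℤ` has periods `N + 2` and `y - x`, hence, by Bézout, their
  -- gcd.
  let W : ℤ → ℕ := fun z => w ⟨(z % ((N + 2 : ℕ) : ℤ)).toNat, by
    have := Int.emod_lt_of_pos z (show (0 : ℤ) < ((N + 2 : ℕ) : ℤ) by positivity)
    have := Int.emod_nonneg z (show ((N + 2 : ℕ) : ℤ) ≠ 0 by positivity)
    omega⟩
  have hWn : Function.Periodic W ((N + 2 : ℕ) : ℤ) := by
    intro z
    simp only [W, Int.add_emod_right]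
  have hWnat : ∀ a : Fin (N + 2), W (a : ℕ) = w a := by
    intro a
    simp only [W]
    congr 1
    ext
    simp only
    rw [← Int.natCast_mod, Int.toNat_natCast, Nat.mod_eq_of_lt a.isLt]
  have hWpow : ∀ (a : Fin (N + 2)) (t : ℕ), W (a + t) = w ((finRotate (N + 2) ^ t) a) := by
    intro a t
    simp only [W]
    congr 1
    ext
    rw [finRotate_pow_apply]
    simp only
    rw [← Nat.cast_add, ← Int.natCast_mod, Int.toNat_natCast]
  have hWs : Function.Periodic W ((y : ℤ) - x) := by
    intro z
    have h1 : ∃ t : ℕ, ∃ q : ℤ, z = (x : ℤ) + t + q * ((N + 2 : ℕ) : ℤ) := by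
      refine ⟨((z - x) % ((N + 2 : ℕ) : ℤ)).toNat, (z - x) / ((N + 2 : ℕ) : ℤ), ?_⟩
      rw [Int.toNat_of_nonneg (Int.emod_nonneg _ (by positivity))]
      have := Int.emod_add_mul_ediv (z - x) ((N + 2 : ℕ) : ℤ)
      linarith
    obtain ⟨t, q, rfl⟩ := h1
    have h2 := hWn.int_mul q
    have h3 : (x : ℤ) + t + q * ((N + 2 : ℕ) : ℤ) + ((y : ℤ) - x) =
        (y : ℤ) + t + q * ((N + 2 : ℕ) : ℤ) := by ring
    have e1 := h2 ((y : ℤ) + t)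
    have e2 := h2 ((x : ℤ) + t)
    simp only [Int.cast_id] at e1 e2
    rw [h3, e1, e2, hWpow, hWpow, hxy t]
  set g := Int.gcd ((y : ℤ) - x) ((N + 2 : ℕ) : ℤ) with hg
  have hWg : Function.Periodic W (g : ℤ) := by
    have e1 := hWs.int_mul (Int.gcdA ((y : ℤ) - x) ((N + 2 : ℕ) : ℤ))
    have e2 := hWn.int_mul (Int.gcdB ((y : ℤ) - x) ((N + 2 : ℕ) : ℤ))
    have e3 := e1.add_period e2
    simp only [Int.cast_id] at e3
    rw [hg, Int.gcd_eq_gcd_ab, mul_comm _ (Int.gcdA _ _), mul_comm _ (Int.gcdB _ _)]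
    exact e3
  have hgpos : 0 < g := Int.gcd_pos_of_ne_zero_right _ (by positivity)
  have hgn : g ∣ N + 2 :=
    Int.natCast_dvd_natCast.1 (Int.gcd_dvd_right ((y : ℤ) - x) ((N + 2 : ℕ) : ℤ))
  have hglt : g < N + 2 := by
    have h1 := Int.gcd_dvd_left ((y : ℤ) - x) ((N + 2 : ℕ) : ℤ)
    have h0 : (y : ℤ) - x ≠ 0 := by
      intro h
      apply hne
      ext
      omega
    have h2 := Int.le_of_dvd (abs_pos.2 h0) ((dvd_abs _ _).2 h1)
    have h3 : |(y : ℤ) - x| < ((N + 2 : ℕ) : ℤ) := by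
      have := x.isLt
      have := y.isLt
      rw [abs_lt]
      omega
    rw [← hg] at h2
    omega
  refine ⟨g, hgpos, ?_, ?_⟩
  · obtain ⟨d, hd⟩ := hgn
    have : 2 ≤ d := by
      by_contra h
      interval_cases d <;> omega
    rw [Nat.le_div_iff_mul_le (by norm_num), hd]
    exact Nat.mul_le_mul_left _ this
  · intro a b hab
    have h1 := hWg.int_mul ((a : ℤ) / g) b
    simp only [Int.cast_id] at h1
    rw [← hWnat, ← hWnat, ← h1, hab]
    congr 1
    have := Int.emod_add_mul_ediv (a : ℤ) g
    push_cast
    linarith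

open Classical in
theorem card_not_isPrimitiveWord_le {N : ℕ} (S : Finset (Fin (N + 2) → ℕ))
    (hS : ∀ w ∈ S, ∀ x, w x < N + 2) :
    (S.filter fun w => ¬ IsPrimitiveWord (finRotate (N + 2)) w).card ≤
      (N + 2) * (N + 2) ^ ((N + 2) / 2) := by
  -- A non-primitive word is recovered from a period and its first `(N + 2) / 2` letters; the
  -- default `0` is never reached for such a period.
  let Φ : Fin (N + 2) × (Fin ((N + 2) / 2) → Fin (N + 2)) → (Fin (N + 2) → ℕ) :=
    fun p x => if h : (x : ℕ) % p.1 < (N + 2) / 2 then p.2 ⟨_, h⟩ else 0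
  have hsub : (S.filter fun w => ¬ IsPrimitiveWord (finRotate (N + 2)) w) ⊆
      Finset.univ.image Φ := by
    intro w hw
    rw [Finset.mem_filter] at hw
    obtain ⟨g, hg0, hg, hper⟩ := exists_period_of_not_isPrimitiveWord hw.2
    rw [Finset.mem_image]
    refine ⟨(⟨g, by omega⟩, fun i => ⟨w ⟨i, by omega⟩, hS w hw.1 _⟩), Finset.mem_univ _, ?_⟩
    funext x
    have h : (x : ℕ) % g < (N + 2) / 2 := lt_of_lt_of_le (Nat.mod_lt _ hg0) hg
    simp only [Φ, h, dif_pos]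
    exact (hper _ _ rfl).symm
  refine (Finset.card_le_card hsub).trans (Finset.card_image_le.trans ?_)
  simp

/-! ### Descent sets and inclusion–exclusion -/

/-- The weakly increasing word whose level sets are the blocks between consecutive elements
of `K`. -/
def blockIndex {n : ℕ} (K : Finset ℕ) (x : Fin n) : ℕ := (K ∩ Finset.Icc 1 (x : ℕ)).card

theorem blockIndex_mono {n : ℕ} (K : Finset ℕ) : Monotone (blockIndex (n := n) K) :=
  fun _ _ h => Finset.card_le_card
    (Finset.inter_subset_inter_left (Finset.Icc_subset_Icc_right h))

theorem blockIndex_lt {n : ℕ} (K : Finset ℕ) (x : Fin n) : blockIndex K x < n := by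
  refine lt_of_le_of_lt (Finset.card_le_card Finset.inter_subset_right) ?_
  simp

theorem mem_descentSet {n : ℕ} {π : Equiv.Perm (Fin n)} {i : ℕ} :
    i ∈ descentSet π ↔ ∃ a b : Fin n, (a : ℕ) + 1 = i ∧ (b : ℕ) + 1 = i + 1 ∧ π b < π a := by
  simp only [descentSet, Finset.mem_filter, Finset.mem_Icc, and_iff_right_iff_imp]
  rintro ⟨a, b, h1, h2, _⟩
  omega

theorem descentSet_subset_iff {n : ℕ} (π : Equiv.Perm (Fin n)) (K : Finset ℕ) :
    descentSet π ⊆ K ↔ IncreasingOnLevels (blockIndex K) π := by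
  constructor
  · intro h x y hxy hc
    have key : ∀ d : ℕ, ∀ y : Fin n, (y : ℕ) = x + d + 1 → blockIndex K x = blockIndex K y →
        π x < π y := by
      have step : ∀ a b : Fin n, (b : ℕ) = a + 1 → blockIndex K a = blockIndex K b →
          π a < π b := by
        intro a b hab he
        by_contra hlt
        have hlt' : π b < π a := lt_of_le_of_ne (not_lt.1 hlt) fun h => by
          have := π.injective h
          subst this
          omega
        have hb : (b : ℕ) ∈ K := h (mem_descentSet.2 ⟨a, b, by omega, by omega, hlt'⟩)
        refine absurd he (ne_of_lt (Finset.card_lt_card ⟨?_, ?_⟩))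
        · exact Finset.inter_subset_inter_left (Finset.Icc_subset_Icc_right (by omega))
        · intro hsub
          have := hsub (Finset.mem_inter.2 ⟨hb, Finset.mem_Icc.2 ⟨by omega, le_rfl⟩⟩)
          simp only [Finset.mem_inter, Finset.mem_Icc] at this
          omega
      intro d
      induction d with
      | zero => exact fun y hy he => step x y hy he
      | succ d ih =>
        intro y hy he
        let z : Fin n := ⟨x + d + 1, by omega⟩
        have hxz : blockIndex K x ≤ blockIndex K z := blockIndex_mono K (Fin.le_def.2 (by simp [z]; omega))
        have hzy : blockIndex K z ≤ blockIndex K y := blockIndex_mono K (Fin.le_def.2 (by simp [z]; omega))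
        exact (ih z rfl (by omega)).trans (step z y (by simp [z]; omega) (by omega))
    have : (x : ℕ) < y := hxy
    exact key (y - x - 1) y (by omega) hc
  · intro h i hi
    obtain ⟨a, b, ha, hb, hlt⟩ := mem_descentSet.1 hi
    by_contra hK
    refine absurd (h a b (Fin.lt_def.2 (by omega)) ?_) (not_lt.2 hlt.le)
    unfold blockIndex
    congr 1
    ext j
    simp only [Finset.mem_inter, Finset.mem_Icc]
    constructor
    · rintro ⟨h1, h2, h3⟩
      exact ⟨h1, h2, by omega⟩
    · rintro ⟨h1, h2, h3⟩
      have : j ≠ i := fun h => hK (h ▸ h1)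
      exact ⟨h1, h2, by omega⟩

/-- A function all of whose subset sums are small is small. -/
theorem abs_le_of_abs_sum_powerset_le (f : Finset ℕ → ℝ) (B : ℝ)
    (h : ∀ K : Finset ℕ, |∑ J ∈ K.powerset, f J| ≤ B) (J : Finset ℕ) :
    |f J| ≤ 2 ^ J.card * B := by
  -- Elements of `S` are forced, those of `T` optional. Forcing one more element writes the sum as a
  -- difference of two earlier ones, doubling the bound.
  have key : ∀ S T : Finset ℕ, Disjoint S T →
      |∑ J ∈ T.powerset, f (S ∪ J)| ≤ 2 ^ S.card * B := by
    intro S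
    induction S using Finset.induction_on with
    | empty =>
      intro T _
      simpa using h T
    | insert a S ha ih =>
      intro T hd
      rw [Finset.disjoint_insert_left] at hd
      have h1 := ih T hd.2
      have h2 := ih (insert a T) (Finset.disjoint_insert_right.2 ⟨ha, hd.2⟩)
      rw [Finset.sum_powerset_insert hd.1] at h2
      have h3 : ∀ J, insert a S ∪ J = S ∪ insert a J := fun J => by
        rw [Finset.insert_union, Finset.union_insert]
      simp only [h3]
      rw [Finset.card_insert_of_notMem ha, pow_succ]
      rw [abs_le] at *
      constructor <;> linarith [h1.1, h1.2, h2.1, h2.2]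
  simpa using key J ∅ (Finset.disjoint_empty_right _)

open Classical in
theorem sum_powerset_beta (n : ℕ) (K : Finset ℕ) :
    ∑ J ∈ K.powerset, beta n J = (rearrangements (blockIndex (n := n) K)).card := by
  rw [← card_increasingOnLevels (blockIndex_mono K)]
  rw [Finset.card_eq_sum_card_fiberwise (f := descentSet) (t := K.powerset)]
  · refine Finset.sum_congr rfl fun J hJ => ?_
    refine Nat.subtype_card _ fun π => ?_
    simp only [Finset.mem_filter, Finset.mem_univ, true_and, ← descentSet_subset_iff]
    exact ⟨fun h => h.2, fun h => ⟨h ▸ Finset.mem_powerset.1 hJ, h⟩⟩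
  · intro π hπ
    simpa [descentSet_subset_iff] using hπ

open Classical in
theorem sum_powerset_betaCyc (N : ℕ) (K : Finset ℕ) :
    (N + 2) * ∑ J ∈ K.powerset, betaCyc (N + 2) J =
      ((rearrangements (blockIndex (n := N + 2) K)).filter
        (IsPrimitiveWord (finRotate (N + 2)))).card := by
  rw [← card_conj_increasingOnLevels (blockIndex_mono K) (exists_pow_finRotate N),
    ← card_fullCycles_mul (IncreasingOnLevels (blockIndex K))]
  congr 1
  rw [Finset.card_eq_sum_card_fiberwise (f := descentSet) (t := K.powerset)]
  · refine Finset.sum_congr rfl fun J hJ => ?_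
    refine Nat.subtype_card _ fun π => ?_
    simp only [Finset.mem_filter, Finset.mem_univ, true_and, ← descentSet_subset_iff]
    exact ⟨fun h => ⟨h.1.1, h.2⟩, fun h => ⟨⟨h.1, h.2 ▸ Finset.mem_powerset.1 hJ⟩, h.2⟩⟩
  · intro π hπ
    simp only [Finset.coe_filter, Finset.mem_univ, true_and, Set.mem_ofPred_eq] at hπ
    simpa [descentSet_subset_iff] using hπ.2

theorem abs_mul_betaCyc_sub_beta_le (N : ℕ) (J : Finset ℕ) :
    |((N + 2 : ℕ) : ℝ) * betaCyc (N + 2) J - beta (N + 2) J| ≤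
      2 ^ J.card * (((N + 2) * (N + 2) ^ ((N + 2) / 2) : ℕ) : ℝ) := by
  classical
  refine abs_le_of_abs_sum_powerset_le
    (fun J => ((N + 2 : ℕ) : ℝ) * betaCyc (N + 2) J - beta (N + 2) J) _ (fun K => ?_) J
  rw [Finset.sum_sub_distrib, ← Finset.mul_sum]
  have h1 := sum_powerset_beta (N + 2) K
  have h2 := sum_powerset_betaCyc N K
  have h3 := Finset.card_filter_add_card_filter_not (s := rearrangements (blockIndex (n := N + 2) K))
    (IsPrimitiveWord (finRotate (N + 2)))
  have h4 := card_not_isPrimitiveWord_le (rearrangements (blockIndex (n := N + 2) K)) (by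
    intro w hw x
    obtain ⟨σ, rfl⟩ := mem_rearrangements.1 hw
    exact blockIndex_lt K _)
  rw [← h1, ← h2] at h3
  have h5 : ((N + 2 : ℕ) : ℝ) * ∑ J ∈ K.powerset, (betaCyc (N + 2) J : ℝ) +
      (((rearrangements (blockIndex (n := N + 2) K)).filter
        fun w => ¬ IsPrimitiveWord (finRotate (N + 2)) w).card : ℝ) =
      ∑ J ∈ K.powerset, (beta (N + 2) J : ℝ) := by exact_mod_cast h3
  rw [← h5, sub_add_cancel_left, abs_neg, Nat.abs_cast]
  exact_mod_cast h4

/-! ### Lower bound for `beta` from level functions -/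

theorem descentSet_eq_of_level_lt {n C : ℕ} {J : Finset ℕ} (hJ : J ⊆ Finset.Icc 1 (n - 1))
    {lev : Fin n → Fin C}
    (hlev : ∀ a b : Fin n, (b : ℕ) = a + 1 →
      ((b : ℕ) ∈ J → lev b < lev a) ∧ ((b : ℕ) ∉ J → lev a < lev b))
    {π : Equiv.Perm (Fin n)} (hπ : ∀ x y, lev x < lev y → π x < π y) : descentSet π = J := by
  ext i
  rw [mem_descentSet]
  constructor
  · rintro ⟨a, b, h1, h2, h3⟩
    by_contra hi
    have hb : (b : ℕ) = i := by omega
    exact lt_asymm h3 (hπ _ _ ((hlev a b (by omega)).2 (hb ▸ hi)))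
  · intro hi
    have h1 := Finset.mem_Icc.1 (hJ hi)
    refine ⟨⟨i - 1, by omega⟩, ⟨i, by omega⟩, by simp; omega, rfl, hπ _ _ ?_⟩
    exact (hlev ⟨i - 1, by omega⟩ ⟨i, by omega⟩ (by simp; omega)).1 hi

/-- If the zigzag poset of `J` has a strict level function with `C` levels, then it has at least
`n! / C ^ n` linear extensions. -/
theorem factorial_le_beta_mul_pow {n C : ℕ} {J : Finset ℕ} (hJ : J ⊆ Finset.Icc 1 (n - 1))
    (lev : Fin n → Fin C)
    (hlev : ∀ a b : Fin n, (b : ℕ) = a + 1 →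
      ((b : ℕ) ∈ J → lev b < lev a) ∧ ((b : ℕ) ∉ J → lev a < lev b)) :
    n.factorial ≤ beta n J * C ^ n := by
  classical
  have hb : beta n J =
      (Finset.univ.filter fun π : Equiv.Perm (Fin n) => descentSet π = J).card :=
    Nat.subtype_card _ (by simp)
  -- There are `C ^ n` possible words `lev ∘ π⁻¹`. On each fibre, composing with the sort of the
  -- word gives an injection into permutations with descent set `J`.
  have h := Finset.card_le_mul_card_image_of_maps_to
    (f := fun π : Equiv.Perm (Fin n) => lev ∘ π.symm)
    (s := Finset.univ) (t := Finset.univ) (fun _ _ => Finset.mem_univ _) (beta n J) ?_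
  · simpa [Fintype.card_perm] using h
  · intro w _
    rw [hb]
    refine Finset.card_le_card_of_injOn (fun π => (Tuple.sort w)⁻¹ * π) ?_ ?_
    · intro π hπ
      simp only [Finset.coe_filter, Finset.mem_univ, true_and, Set.mem_ofPred_eq] at hπ ⊢
      refine descentSet_eq_of_level_lt hJ hlev fun x y hxy => ?_
      by_contra hlt
      have h1 := Tuple.monotone_sort w (not_lt.1 hlt)
      have h2 : ∀ z, (w ∘ Tuple.sort w) (((Tuple.sort w)⁻¹ * π) z) = lev z := by
        intro z
        change w (Tuple.sort w ((Tuple.sort w).symm (π z))) = lev z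
        rw [Equiv.apply_symm_apply, ← hπ]
        simp
      rw [h2, h2] at h1
      exact absurd hxy (not_lt.2 h1)
    · intro π _ π' _ h
      exact mul_left_cancel h

section Levels

open Classical in
/-- The number of consecutive ascents that end in position `x`, when the descents are at `I`. -/
noncomputable def ascentRun (I : Set ℕ) : ℕ → ℕ
  | 0 => 0
  | x + 1 => if x + 1 ∈ I then 0 else ascentRun I x + 1

theorem ascentRun_le (I : Set ℕ) (x : ℕ) : ascentRun I x ≤ x := by
  induction x with
  | zero => simp [ascentRun]
  | succ x ih =>
    rw [ascentRun]
    split_ifs <;> omega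

theorem notMem_of_lt_ascentRun {I : Set ℕ} {x t : ℕ} (h : t < ascentRun I x) : x - t ∉ I := by
  induction x generalizing t with
  | zero => simp [ascentRun] at h
  | succ x ih =>
    rw [ascentRun] at h
    split_ifs at h with hx
    · omega
    · rcases t with _ | t
      · exact hx
      · have := ih (t := t) (by omega)
        rwa [Nat.add_sub_add_right]

/-- The level of `x` adds the length of the descent run leaving `x` to that of the ascent run ending
there; each is below `k`. A descent shortens the first and cannot lengthen the second; an ascent
starts with the first zero and lengthens the second. -/
theorem exists_level {I : Set ℕ} {k : ℕ}
    (hI : ∀ a, 1 ≤ a → (∃ t < k, a + t ∈ I) ∧ ∃ t < k, a + t ∉ I) :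
    ∃ lev : ℕ → ℕ, (∀ x, lev x < 2 * k) ∧
      ∀ x, (x + 1 ∈ I → lev (x + 1) < lev x) ∧ (x + 1 ∉ I → lev x < lev (x + 1)) := by
  classical
  have hd : ∀ x, ∃ t, t < k ∧ x + 1 + t ∉ I := fun x => (hI (x + 1) (by omega)).2
  let d : ℕ → ℕ := fun x => Nat.find (hd x)
  have hdlt : ∀ x, d x < k := fun x => (Nat.find_spec (hd x)).1
  have hd0 : ∀ x, x + 1 ∉ I → d x = 0 := by
    intro x hx
    have := hdlt x
    exact (Nat.find_eq_zero (hd x)).2 ⟨by omega, hx⟩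
  have hd1 : ∀ x, x + 1 ∈ I → d (x + 1) < d x := by
    intro x hx
    have h1 := Nat.find_spec (hd x)
    have h2 : d x ≠ 0 := by
      intro h
      change d x < k ∧ x + 1 + d x ∉ I at h1
      rw [h] at h1
      exact h1.2 hx
    have h3 : d (x + 1) ≤ d x - 1 := by
      refine Nat.find_min' (hd (x + 1)) ⟨by have := hdlt x; omega, ?_⟩
      have : x + 1 + 1 + (d x - 1) = x + 1 + d x := by omega
      rw [this]
      exact h1.2
    omega
  have halt : ∀ x, ascentRun I x < k := by
    intro x
    by_contra h
    have h0 := ascentRun_le I x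
    have hk : 0 < k := lt_of_le_of_lt (Nat.zero_le _) (hdlt 0)
    obtain ⟨t, ht, hmem⟩ := (hI (x - k + 1) (by omega)).1
    have h1 := notMem_of_lt_ascentRun (I := I) (x := x) (t := k - 1 - t) (by omega)
    have h2 : x - (k - 1 - t) = x - k + 1 + t := by omega
    exact h1 (h2 ▸ hmem)
  refine ⟨fun x => d x + ascentRun I x, fun x => ?_, fun x => ⟨fun hx => ?_, fun hx => ?_⟩⟩
  · have := hdlt x
    have := halt x
    dsimp only
    omega
  · have := hd1 x hx
    simp only [ascentRun, hx, if_true]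
    omega
  · have := hd0 x hx
    simp only [ascentRun, hx, if_false]
    omega

theorem IsPeriodic.mem_add_mul_iff {ℓ : ℕ} {I : Set ℕ} (h : IsPeriodic ℓ I) {i : ℕ} (hi : 1 ≤ i)
    (m : ℕ) : i + ℓ * m ∈ I ↔ i ∈ I := by
  induction m with
  | zero => simp
  | succ m ih =>
    rw [← ih, mul_add, mul_one, ← add_assoc]
    exact (h (i + ℓ * m) (le_add_right hi)).symm

theorem IsPeriodic.mem_iff_of_modEq {ℓ : ℕ} {I : Set ℕ} (h : IsPeriodic ℓ I) {i j : ℕ}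
    (hi : 1 ≤ i) (hj : 1 ≤ j) (hij : i ≡ j [MOD ℓ]) : i ∈ I ↔ j ∈ I := by
  wlog hle : i ≤ j generalizing i j
  · exact (this hj hi hij.symm (by omega)).symm
  obtain ⟨m, hm⟩ := (Nat.modEq_iff_dvd' hle).1 hij
  have : j = i + ℓ * m := by omega
  rw [this, h.mem_add_mul_iff hi]

theorem IsPeriodic.exists_add_mem_iff {ℓ k : ℕ} {I : Set ℕ} (h : IsPeriodic ℓ I) (hℓ : 1 ≤ ℓ)
    (hk : ℓ ≤ k) {i a : ℕ} (hi : 1 ≤ i) (ha : 1 ≤ a) : ∃ t < k, (a + t ∈ I ↔ i ∈ I) := by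
  -- The residue of `i - a` modulo `ℓ`; adding `ℓ * a` avoids truncated subtraction.
  refine ⟨(i + ℓ * a - a) % ℓ, (Nat.mod_lt _ hℓ).trans_le hk,
    h.mem_iff_of_modEq (by omega) hi ?_⟩
  have h1 : a ≤ ℓ * a := Nat.le_mul_of_pos_left a hℓ
  have h2 : a + (i + ℓ * a - a) = i + ℓ * a := by omega
  calc a + (i + ℓ * a - a) % ℓ ≡ a + (i + ℓ * a - a) [MOD ℓ] :=
        Nat.ModEq.add_left a (Nat.mod_modEq _ _)
    _ = i + ℓ * a := h2
    _ ≡ i [MOD ℓ] := by simp [Nat.ModEq]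

end Levels

theorem factorial_le_beta_mul_pow_of_mem_periodicFamily {k n : ℕ} {J : Finset ℕ}
    (hJ : J ∈ periodicFamily k n) : n.factorial ≤ beta n J * (2 * k) ^ n := by
  classical
  simp only [periodicFamily, Finset.mem_filter, Finset.mem_powerset] at hJ
  obtain ⟨hsub, I, hne, hlt, ⟨ℓ, hℓ, hℓk, hper⟩, hJI⟩ := hJ
  obtain ⟨i, hi⟩ := Set.empty_ssubset.1 hne
  obtain ⟨j, hj, hjI⟩ := Set.exists_of_ssubset hlt
  obtain ⟨lev, hlev, hstep⟩ := exists_level (I := I) (k := k) fun a ha => by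
    obtain ⟨t, ht, h1⟩ := hper.exists_add_mem_iff hℓ hℓk (hlt.1 hi) ha
    obtain ⟨s, hs, h2⟩ := hper.exists_add_mem_iff hℓ hℓk hj ha
    exact ⟨⟨t, ht, h1.2 hi⟩, s, hs, fun h => hjI (h2.1 h)⟩
  refine factorial_le_beta_mul_pow hsub (fun x => ⟨lev x, hlev x⟩) fun a b hab => ?_
  have hb : (b : ℕ) ∈ J ↔ (a : ℕ) + 1 ∈ I := by
    rw [← Finset.mem_coe, hJI, hab]
    simp only [Set.mem_inter_iff, Set.mem_Icc, and_iff_left_iff_imp]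
    intro _
    omega
  rw [hb]
  simp only [Fin.mk_lt_mk, hab]
  exact hstep a

/-! ### The uniform error bound and its limit -/

theorem abs_ratio_sub_one_le {k N : ℕ} {J : Finset ℕ} (hJ : J ∈ periodicFamily k (N + 2)) :
    |((N + 2 : ℕ) : ℝ) * betaCyc (N + 2) J / beta (N + 2) J - 1| ≤
      2 ^ (N + 2) * ((N + 2 : ℕ) * (N + 2 : ℕ) ^ ((N + 2) / 2)) * (2 * k) ^ (N + 2) /
        (N + 2).factorial := by
  classical
  have h1 := factorial_le_beta_mul_pow_of_mem_periodicFamily hJ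
  have h2 := abs_mul_betaCyc_sub_beta_le N J
  have hbpos : (0 : ℝ) < beta (N + 2) J := by
    have : beta (N + 2) J ≠ 0 := by
      intro h
      rw [h, zero_mul] at h1
      exact absurd h1 (not_le.2 (Nat.factorial_pos _))
    positivity
  have hcard : J.card ≤ N + 2 := by
    have : J ⊆ Finset.Icc 1 (N + 2 - 1) :=
      Finset.mem_powerset.1 (Finset.mem_filter.1 hJ).1
    have := Finset.card_le_card this
    simp only [Nat.card_Icc] at this
    omega
  have h3 : ((N + 2).factorial : ℝ) ≤ beta (N + 2) J * (2 * k) ^ (N + 2) := by exact_mod_cast h1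
  have h4 : |((N + 2 : ℕ) : ℝ) * betaCyc (N + 2) J - beta (N + 2) J| ≤
      2 ^ (N + 2) * ((N + 2 : ℕ) * (N + 2 : ℕ) ^ ((N + 2) / 2)) := by
    refine h2.trans ?_
    push_cast
    gcongr
    norm_num
  rw [div_sub_one hbpos.ne', abs_div, abs_of_pos hbpos,
    div_le_div_iff₀ hbpos (by positivity)]
  calc _ ≤ 2 ^ (N + 2) * ((N + 2 : ℕ) * (N + 2 : ℕ) ^ ((N + 2) / 2)) *
        (beta (N + 2) J * (2 * k) ^ (N + 2) : ℝ) := by gcongr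
    _ = _ := by ring

/-- With `h = n / 2`, the inequality `h! * h ^ h ≤ n!` absorbs `n ^ h ≤ 3 ^ h * h ^ h` and leaves
`h!` below. The exponentials combine to `(8 * k) ^ n`, using `n ≤ 2 ^ n`, and `192 = 8 ^ 2 * 3`. -/
theorem error_bound_le {k n : ℕ} (hk : 1 ≤ k) (hn : 2 ≤ n) :
    (2 : ℝ) ^ n * (n * n ^ (n / 2)) * (2 * k) ^ n / n.factorial ≤
      8 * k * ((192 * k ^ 2) ^ (n / 2) / (n / 2).factorial) := by
  set h := n / 2 with hh
  have h1 : (n : ℝ) ≤ 2 ^ n := by exact_mod_cast Nat.lt_two_pow_self.le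
  have hn3 : n ≤ 3 * h := by omega
  have h2 : (n : ℝ) ^ h ≤ 3 ^ h * h ^ h := by
    rw [← mul_pow]
    gcongr
    exact_mod_cast hn3
  have hk' : (1 : ℝ) ≤ k := by exact_mod_cast hk
  have h3 : (8 * k : ℝ) ^ n ≤ (8 * k) ^ (2 * h + 1) :=
    pow_le_pow_right₀ (by linarith) (by omega)
  have h4 : (h.factorial : ℝ) * h ^ h ≤ n.factorial := by
    have e1 : h.factorial * (h + 1) ^ h ≤ (h + h).factorial := Nat.factorial_mul_pow_le_factorial
    have e2 : (h + h).factorial ≤ n.factorial := Nat.factorial_le (by omega)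
    have e3 : h ^ h ≤ (h + 1) ^ h := Nat.pow_le_pow_left (by omega) _
    exact_mod_cast (Nat.mul_le_mul_left _ e3).trans (e1.trans e2)
  rw [mul_div_assoc', div_le_div_iff₀ (by positivity) (by positivity)]
  calc (2 : ℝ) ^ n * (n * n ^ h) * (2 * k) ^ n * h.factorial
      ≤ 2 ^ n * (2 ^ n * (3 ^ h * h ^ h)) * (2 * k) ^ n * h.factorial := by gcongr
    _ = (8 * k) ^ n * 3 ^ h * (h.factorial * h ^ h) := by
        rw [show (8 * k : ℝ) = 2 * 2 * (2 * k) by ring, mul_pow (2 * 2 : ℝ), mul_pow (2 : ℝ) 2]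
        ring
    _ ≤ (8 * k) ^ (2 * h + 1) * 3 ^ h * n.factorial := by gcongr
    _ = 8 * k * (192 * k ^ 2) ^ h * n.factorial := by
        rw [show (192 * k ^ 2 : ℝ) = (8 * k) ^ 2 * 3 by ring, mul_pow _ (3 : ℝ), ← pow_mul,
          pow_succ]
        ring

end CyclicDescents

theorem mainTheorem5 (k : ℕ) (hk : 2 ≤ k) :
    Tendsto
      (fun n : ℕ =>
        (CyclicDescents.periodicFamily k n).sup' (CyclicDescents.periodicFamily_nonempty hk n)
          (fun J =>
            |(n : ℝ) * (CyclicDescents.betaCyc n J : ℝ) / (CyclicDescents.beta n J : ℝ) - 1|))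
      atTop (𝓝 0) := by
  have hlim : Tendsto (fun n : ℕ =>
      8 * (k : ℝ) * ((192 * (k : ℝ) ^ 2) ^ (n / 2) / (n / 2).factorial)) atTop (𝓝 0) := by
    have h1 := (FloorSemiring.tendsto_pow_div_factorial_atTop (192 * (k : ℝ) ^ 2)).comp
      (Nat.tendsto_div_const_atTop two_ne_zero)
    simpa using h1.const_mul (8 * (k : ℝ))
  refine squeeze_zero' (Eventually.of_forall fun n => ?_) ?_ hlim
  · obtain ⟨J, hJ⟩ := CyclicDescents.periodicFamily_nonempty hk n
    exact (abs_nonneg _).trans (Finset.le_sup' (f := fun J =>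
      |(n : ℝ) * (CyclicDescents.betaCyc n J : ℝ) / (CyclicDescents.beta n J : ℝ) - 1|) hJ)
  · filter_upwards [eventually_ge_atTop 2] with n hn
    refine Finset.sup'_le _ _ fun J hJ => ?_
    obtain ⟨N, rfl⟩ := Nat.exists_eq_add_of_le' hn
    exact (CyclicDescents.abs_ratio_sub_one_le hJ).trans
      (CyclicDescents.error_bound_le (by omega) hn)
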